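/- \textbf{Setting.} Let $m,n\ge 1$, let $(\mathcal A,\tau)$ be a unital complex $*$-algebra (for example a $C^*$-algebra) with a tracial state $\tau$, and let $(e_{ij})_{i,j\le m+n}$ be matrix units in $\mathcal A$: $e_{ij}e_{kl}=\delta_{jk}e_{il}$, $e_{ij}^*=e_{ji}$, $\sum_i e_{ii}=1$. Put $p_m=\sum_{i\le m}e_{ii}$ and $p_n=\sum_{m<i\le m+n}e_{ii}$. Let $\hat x=\hat x^*\in\mathcal A$ satisfy $\hat x=p_m\hat xp_m$, and suppose that $\hat x$ and $\{e_{ij}\}_{i,j\le m+n}$ are free with amalgamation over $\langle p_m,p_n\rangle$ with respect to $\psi(a)=\tau(p_m)^{-1}\tau(p_map_m)\,p_m+\tau(p_n)^{-1}\tau(p_nap_n)\,p_n$. Here, if $\mathcal B$ is a unital $*$-subalgebra of a unital $*$-algebra $\mathcal M$ and $\mathbb E:\mathcal M\to\mathcal B$ is a conditional expectation (linear, $\mathbb E(bab')=b\,\mathbb E(a)\,b'$ for $b,b'\in\mathcal B$, $\mathbb E(1)=1$), subsets $S_1,S_2\subseteq\mathcal M$ are \emph{free with amalgamation over $\mathcal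 B$} if $\mathbb E\big[(a_1-\mathbb E(a_1))\cdots(a_r-\mathbb E(a_r))\big]=0$ whenever $r\ge1$, $a_k\in\langle S_{j(k)},\mathcal B\rangle$ (the $*$-algebra generated by $S_{j(k)}$ and $\mathcal B$) and $j(1)\ne j(2)\ne\dots\ne j(r)$. Let $\varphi:M_m(\mathbb C)\to M_n(\mathbb C)$ be a linear map whose Choi matrix $$C=\sum_{i,j=1}^m\varphi(E_{ij})\otimes E_{ij}\in M_n(\mathbb C)\otimes M_m(\mathbb C)=M_{nm}(\mathbb C)$$ is self-adjoint, and let $(v_s)_{s\le mn}$ be an orthonormal basis of $\mathbb C^n\otimes\mathbb C^m$ with $Cv_s=\lambda_sv_s$, $\lambda_s\in\mathbb R$. Let $\rho_1,\dots,\rho_r$ be the distinct nonzero eigenvalues of $C$, and put $$J_t=\{s:\lambda_s=\rho_t\},\qquad w_s=\sum_{i=1}^n\sum_{j=1}^m\langle E_i\otimes E_j,v_s\rangle\,e_{m+i,j},\qquad Q_t=\sum_{s\in J_t}w_sw_s^*,\qquad f=\sum_{s:\lambda_s\ne0}w_s^*\otimes v_s.$$ Thus $ff^*=\sum_{s,s':\,\lambda_s,\lambda_{s'}\neq0}w_s^*w_{s'}\otimes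 v_sv_{s'}^*\in\mathcal A\otimes M_{nm}(\mathbb C)$. The eigenspaces of $C$ are \emph{tracially well behaved} if for all $k\ge0$, all $i_1,\dots,i_k\le r$ and all $j_1,j_1',j_2\le mn$ such that $j_1,j_1'\in J_i$ for some $i\le r$, $$\tau(w_{j_1}w_{j_2}^*Q_{i_1}\cdots Q_{i_k})=\delta_{j_1j_2}\,\tau(w_{j_1}w_{j_1}^*Q_{i_1}\cdots Q_{i_k})=\delta_{j_1j_2}\,\tau(w_{j_1'}w_{j_1'}^*Q_{i_1}\cdots Q_{i_k}).$$ \textbf{Theorem.} Suppose that the eigenspaces of $C$ are tracially well behaved. Let $\mathcal B=\langle p_m,p_n\rangle\otimes\langle C\rangle$ be the unital $*$-subalgebra of $\mathcal A\otimes M_{nm}(\mathbb C)$ generated by $p_m\otimes1$, $p_n\otimes1$ and $1\otimes C$. Then $\mathcal B$ is commutative, there is a unique conditional expectation $\mathbb E:\mathcal A\otimes M_{nm}(\mathbb C)\to\mathcal B$ that preserves $\tau\otimes\mathrm{tr}$ (where $\mathrm{tr}=\frac1{nm}\mathrm{Tr}$), and $\hat x\otimes C$ and $ff^*$ are free with amalgamation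 over $\mathcal B$ with respect to $\mathbb E$. -/

import Mathlib

open scoped ComplexOrder Kronecker Matrix

noncomputable section

namespace BlockModified

section OperatorValued

variable {M : Type*} [Ring M] [StarRing M] [Algebra ℂ M] [StarModule ℂ M]

/-- A state on a unital `*`-algebra (a unital positive linear functional) that is tracial. -/
structure IsTracialState (τ : M →ₗ[ℂ] ℂ) : Prop where
  map_one : τ 1 = 1
  nonneg : ∀ a, 0 ≤ τ (star a * a)
  trace : ∀ a b, τ (a * b) = τ (b * a)

/-- `E` is a conditional expectation of `M` onto the unital `*`-subalgebra `B`. -/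
structure IsCondExp (B : StarSubalgebra ℂ M) (E : M →ₗ[ℂ] M) : Prop where
  mem : ∀ a, E a ∈ B
  bimodule : ∀ b ∈ B, ∀ b' ∈ B, ∀ a, E (b * a * b') = b * E a * b'
  map_one : E 1 = 1

/-- Freeness with amalgamation over `B`, with respect to `E`, of a family of subsets `S i`:
`E` vanishes on every nonempty product of centred elements `a - E a`, where the `a` are
taken from the `*`-algebras generated by the `S i` and `B`, neighbours coming from different
indices. A word is a list of pairs (index, element). -/
def FreeOver {ι : Type*} (B : StarSubalgebra ℂ M) (E : M →ₗ[ℂ] M) (S : ι → Set M) : Prop :=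
  ∀ l : List (ι × M), l ≠ [] →
    (l.map Prod.fst).IsChain (· ≠ ·) →
    (∀ q ∈ l, q.2 ∈ StarAlgebra.adjoin ℂ (S q.1 ∪ (B : Set M))) →
    E ((l.map fun q => q.2 - E q.2).prod) = 0

/-- A complete system of matrix units indexed by `ι`. -/
structure IsMatrixUnits {ι : Type*} [Fintype ι] [DecidableEq ι] (e : ι → ι → M) : Prop where
  mul : ∀ i j k l, e i j * e k l = if j = k then e i l else 0
  star : ∀ i j, star (e i j) = e j i
  sum_diag : ∑ i, e i i = 1

/-- The linear map `a ↦ τ(p)⁻¹ τ(p a p) p + τ(q)⁻¹ τ(q a q) q`, which for orthogonal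
projections `p + q = 1` of nonzero trace is the `τ`-preserving conditional expectation
onto `⟨p, q⟩`. -/
def cornerExp (τ : M →ₗ[ℂ] ℂ) (p q : M) : M →ₗ[ℂ] M where
  toFun a := ((τ p)⁻¹ * τ (p * a * p)) • p + ((τ q)⁻¹ * τ (q * a * q)) • q
  map_add' a b := by
    simp only [mul_add, add_mul, map_add, add_smul]
    abel
  map_smul' c a := by
    simp only [mul_smul_comm, smul_mul_assoc, map_smul, smul_eq_mul, RingHom.id_apply,
      smul_add, smul_smul]
    congr 2 <;> ring

/-- The elementary tensor `a ⊗ X`, as a matrix with entries in `M`. -/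
def tensor {κ : Type*} (a : M) (X : Matrix κ κ ℂ) : Matrix κ κ M :=
  X.map fun c => c • a

/-- The functional `τ ⊗ tr` (normalized trace) on matrices with entries in `M`. -/
def tensorTrace {κ : Type*} [Fintype κ] (τ : M →ₗ[ℂ] ℂ) (X : Matrix κ κ M) : ℂ :=
  (Fintype.card κ : ℂ)⁻¹ * ∑ a, τ (X a a)

end OperatorValued

variable {m n : ℕ}

/-- The Choi matrix `∑ i j, φ(E i j) ⊗ E i j` of a linear map `φ : M_m(ℂ) → M_n(ℂ)`. -/
def choi (φ : Matrix (Fin m) (Fin m) ℂ →ₗ[ℂ] Matrix (Fin n) (Fin n) ℂ) :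
    Matrix (Fin n × Fin m) (Fin n × Fin m) ℂ :=
  ∑ i : Fin m, ∑ j : Fin m, φ (Matrix.single i j 1) ⊗ₖ Matrix.single i j (1 : ℂ)

variable {A : Type*} [Ring A] [StarRing A] [Algebra ℂ A] [StarModule ℂ A]

/-- `p_m`, the sum of the first `m` diagonal matrix units. The index set of the matrix units
is `{1, …, m + n}`, written as the disjoint union of `Fin m` and `Fin n`. -/
def projM (e : Fin m ⊕ Fin n → Fin m ⊕ Fin n → A) : A := ∑ i : Fin m, e (.inl i) (.inl i)

/-- `p_n`, the sum of the last `n` diagonal matrix units. -/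
def projN (e : Fin m ⊕ Fin n → Fin m ⊕ Fin n → A) : A := ∑ i : Fin n, e (.inr i) (.inr i)

/-- An orthonormal basis `v_s`, `s ≤ m n`, of `ℂⁿ ⊗ ℂᵐ`. -/
abbrev TensorBasis (m n : ℕ) :=
  OrthonormalBasis (Fin (m * n)) ℂ (EuclideanSpace ℂ (Fin n × Fin m))

/-- `w_s = ∑ i j, ⟨E_i ⊗ E_j, v_s⟩ e_{m+i,j}`. -/
def w (e : Fin m ⊕ Fin n → Fin m ⊕ Fin n → A) (v : TensorBasis m n) (s : Fin (m * n)) : A :=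
  ∑ i : Fin n, ∑ j : Fin m, v s (i, j) • e (.inr i) (.inl j)

/-- `Q_ρ`, the sum of the `w_s w_s^*` over the indices `s` whose eigenvalue is `ρ`. -/
def Q (e : Fin m ⊕ Fin n → Fin m ⊕ Fin n → A) (v : TensorBasis m n) (lam : Fin (m * n) → ℝ)
    (ρ : ℝ) : A :=
  ∑ s with lam s = ρ, w e v s * star (w e v s)

/-- The column `f = ∑ w_s^* ⊗ v_s`, the sum being over the eigenvectors of nonzero eigenvalue. -/
def f (e : Fin m ⊕ Fin n → Fin m ⊕ Fin n → A) (v : TensorBasis m n) (lam : Fin (m * n) → ℝ) :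
    Matrix (Fin n × Fin m) Unit A :=
  Matrix.of fun a _ => ∑ s with lam s ≠ 0, v s a • star (w e v s)

/-- Tracially well behaved eigenspaces. The distinct nonzero eigenvalues serve as the labels
`i ≤ r` of the eigenspaces; `L` is the word `i_1, …, i_k`. -/
def TraciallyWellBehaved (τ : A →ₗ[ℂ] ℂ) (e : Fin m ⊕ Fin n → Fin m ⊕ Fin n → A)
    (v : TensorBasis m n) (lam : Fin (m * n) → ℝ) : Prop :=
  ∀ L : List ℝ, (∀ ρ ∈ L, ρ ≠ 0 ∧ ∃ s, lam s = ρ) →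
    ∀ j₁ j₁' j₂ : Fin (m * n), lam j₁ ≠ 0 → lam j₁' = lam j₁ →
      τ (w e v j₁ * star (w e v j₂) * (L.map (Q e v lam)).prod) =
          (if j₁ = j₂ then τ (w e v j₁ * star (w e v j₁) * (L.map (Q e v lam)).prod) else 0) ∧
      τ (w e v j₁ * star (w e v j₂) * (L.map (Q e v lam)).prod) =
          (if j₁ = j₂ then τ (w e v j₁' * star (w e v j₁') * (L.map (Q e v lam)).prod) else 0)

/-- The unital `*`-algebra `⟨p_m, p_n⟩ ⊗ ⟨C⟩` generated by `p_m ⊗ 1`, `p_n ⊗ 1` and `1 ⊗ C`. -/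
def algB (e : Fin m ⊕ Fin n → Fin m ⊕ Fin n → A) (C : Matrix (Fin n × Fin m) (Fin n × Fin m) ℂ) :
    StarSubalgebra ℂ (Matrix (Fin n × Fin m) (Fin n × Fin m) A) :=
  StarAlgebra.adjoin ℂ {tensor (projM e) 1, tensor (projN e) 1, tensor 1 C}

end BlockModified

end

/-! Everything becomes transparent in the eigenbasis `v` of `C`. There `1 ⊗ C` is diagonal, and `B`
turns into the diagonal matrices with entries in `⟨p, q⟩` that depend only on the eigenvalue
(`mem_adjoin_tensor_iff`); commutativity is then clear. The expectation applies `ψ = cornerExp τ p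
q` to the diagonal entries and averages over each eigenspace (`diagAvg`, `basisExp`). It is unique
because `τ ⊗ tr` is faithful on `B`, even if `τ` is not faithful on `A`.

The algebra generated by `x ⊗ C` and `B` lies among the diagonal matrices, constant on eigenspaces,
with entries in `⟨x, p, q⟩`. The matrix `f f^*` has entries `w_s^* w_t` for nonzero eigenvalues, and
with `B` it generates matrices whose entries, up to a diagonal from `B`, are `w_s^* h w_t` with `h`
in the algebra of the `Q_ρ` and depending only on the two eigenvalues. Tracial good behaviour makes
`ψ` of such a matrix diagonal and constant on eigenspaces (`diagAvg_of_mem_sandwichSubalgebra`).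

So on both algebras the expectation is `ψ` applied entrywise, and centred matrices have centred
entries. An alternating product of centred matrices has as entries sums of alternating products of
centred elements, which `ψ` kills by the assumed freeness (`FreeOver.map_list_prod_apply`,
`freeOver_basisExp`). -/

set_option linter.unusedSectionVars false
open scoped ComplexOrder Kronecker Matrix

noncomputable section

namespace BlockModified

/-! ### Complementary projections and the algebra they span. -/

section

variable {A : Type*} [Ring A] [StarRing A] [Algebra ℂ A] [StarModule ℂ A]

/-- `p` and `q` are complementary self-adjoint projections. -/
structure IsComplProj (p q : A) : Prop where
  idem : p * p = p
  star_eq : star p = p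
  add_eq : p + q = 1

namespace IsComplProj

variable {p q : A} (h : IsComplProj p q)
include h

theorem eq_one_sub : q = 1 - p := eq_sub_of_add_eq' h.add_eq

theorem mul_right : p * q = 0 := by
  rw [h.eq_one_sub, mul_sub, mul_one, h.idem, sub_self]

theorem mul_left : q * p = 0 := by
  rw [h.eq_one_sub, sub_mul, one_mul, h.idem, sub_self]

theorem idem' : q * q = q := by
  nth_rw 1 [h.eq_one_sub]
  rw [sub_mul, one_mul, h.mul_right, sub_zero]

theorem star_eq' : star q = q := by
  rw [h.eq_one_sub, star_sub, star_one, h.star_eq]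

theorem comb_mul (a b c d : ℂ) :
    (a • p + b • q) * (c • p + d • q) = (a * c) • p + (b * d) • q := by
  simp only [add_mul, mul_add, smul_mul_smul_comm, h.idem, h.idem', h.mul_left, h.mul_right,
    smul_zero, add_zero, zero_add]

theorem star_comb (a b : ℂ) : star (a • p + b • q) = star a • p + star b • q := by
  simp only [star_add, star_smul, h.star_eq, h.star_eq']

theorem algebraMap_eq (r : ℂ) : algebraMap ℂ A r = r • p + r • q := by
  rw [← smul_add, h.add_eq, Algebra.algebraMap_eq_smul_one]

theorem mem_adjoin_iff {a : A} :
    a ∈ StarAlgebra.adjoin ℂ {p, q} ↔ ∃ α β : ℂ, a = α • p + β • q := by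
  constructor
  · intro ha
    induction ha using StarAlgebra.adjoin_induction with
    | mem x hx =>
      rcases hx with rfl | rfl
      · exact ⟨1, 0, by simp⟩
      · exact ⟨0, 1, by simp⟩
    | algebraMap r => exact ⟨r, r, h.algebraMap_eq r⟩
    | add x y _ _ hx hy =>
      obtain ⟨a, b, rfl⟩ := hx
      obtain ⟨c, d, rfl⟩ := hy
      exact ⟨a + c, b + d, by simp only [add_smul]; abel⟩
    | mul x y _ _ hx hy =>
      obtain ⟨a, b, rfl⟩ := hx
      obtain ⟨c, d, rfl⟩ := hy
      exact ⟨_, _, h.comb_mul a b c d⟩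
    | star x _ hx =>
      obtain ⟨a, b, rfl⟩ := hx
      exact ⟨_, _, h.star_comb a b⟩
  · rintro ⟨α, β, rfl⟩
    exact add_mem (SMulMemClass.smul_mem _ (StarAlgebra.subset_adjoin _ _ (by simp)))
      (SMulMemClass.smul_mem _ (StarAlgebra.subset_adjoin _ _ (by simp)))

theorem commute_of_mem {a b : A} (ha : a ∈ StarAlgebra.adjoin ℂ {p, q})
    (hb : b ∈ StarAlgebra.adjoin ℂ {p, q}) : a * b = b * a := by
  obtain ⟨x, y, rfl⟩ := h.mem_adjoin_iff.1 ha
  obtain ⟨z, t, rfl⟩ := h.mem_adjoin_iff.1 hb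
  rw [h.comb_mul, h.comb_mul, mul_comm x, mul_comm y]

end IsComplProj

/-! ### The expectation onto `⟨p, q⟩`. -/

section CornerExp

variable {τ : A →ₗ[ℂ] ℂ} {p q : A}

theorem cornerExp_apply (a : A) :
    cornerExp τ p q a = ((τ p)⁻¹ * τ (p * a * p)) • p + ((τ q)⁻¹ * τ (q * a * q)) • q := rfl

theorem cornerExp_mem (h : IsComplProj p q) (a : A) :
    cornerExp τ p q a ∈ StarAlgebra.adjoin ℂ {p, q} :=
  h.mem_adjoin_iff.2 ⟨_, _, cornerExp_apply a⟩

theorem cornerExp_bimodule (h : IsComplProj p q) {b b' : A}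
    (hb : b ∈ StarAlgebra.adjoin ℂ {p, q}) (hb' : b' ∈ StarAlgebra.adjoin ℂ {p, q}) (a : A) :
    cornerExp τ p q (b * a * b') = b * cornerExp τ p q a * b' := by
  obtain ⟨x, y, rfl⟩ := h.mem_adjoin_iff.1 hb
  obtain ⟨z, t, rfl⟩ := h.mem_adjoin_iff.1 hb'
  have hp : p * ((x • p + y • q) * a * (z • p + t • q)) * p = (x * z) • (p * a * p) := by
    have h1 : p * (x • p + y • q) = x • p := by
      simp [mul_add, h.idem, h.mul_right]
    have h2 : (z • p + t • q) * p = z • p := by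
      simp [add_mul, h.idem, h.mul_left]
    rw [← mul_assoc, ← mul_assoc, h1, mul_assoc _ _ p, h2]
    simp only [smul_mul_assoc, mul_smul_comm, smul_smul, mul_comm]
  have hq : q * ((x • p + y • q) * a * (z • p + t • q)) * q = (y * t) • (q * a * q) := by
    have h1 : q * (x • p + y • q) = y • q := by
      simp [mul_add, h.idem', h.mul_left]
    have h2 : (z • p + t • q) * q = t • q := by
      simp [add_mul, h.idem', h.mul_right]
    rw [← mul_assoc, ← mul_assoc, h1, mul_assoc _ _ q, h2]
    simp only [smul_mul_assoc, mul_smul_comm, smul_smul, mul_comm]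
  rw [cornerExp_apply, cornerExp_apply, hp, hq, h.comb_mul, h.comb_mul, map_smul, map_smul]
  congr 2 <;> simp only [smul_eq_mul] <;> ring

theorem cornerExp_one (h : IsComplProj p q) (hp : τ p ≠ 0) (hq : τ q ≠ 0) :
    cornerExp τ p q 1 = 1 := by
  rw [cornerExp_apply, mul_one, mul_one, h.idem, h.idem', inv_mul_cancel₀ hp, inv_mul_cancel₀ hq,
    one_smul, one_smul, h.add_eq]

theorem cornerExp_of_mem (h : IsComplProj p q) (hp : τ p ≠ 0) (hq : τ q ≠ 0) {b : A}
    (hb : b ∈ StarAlgebra.adjoin ℂ {p, q}) : cornerExp τ p q b = b := by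
  simpa [cornerExp_one h hp hq] using cornerExp_bimodule (τ := τ) h hb (one_mem _) 1

theorem trace_cornerExp (hτ : IsTracialState τ) (h : IsComplProj p q) (hp : τ p ≠ 0)
    (hq : τ q ≠ 0) (a : A) : τ (cornerExp τ p q a) = τ a := by
  rw [cornerExp_apply, map_add, map_smul, map_smul, hτ.trace (p * a) p, hτ.trace (q * a) q,
    ← mul_assoc, ← mul_assoc, h.idem, h.idem']
  simp only [smul_eq_mul]
  rw [mul_right_comm, inv_mul_cancel₀ hp, mul_right_comm, inv_mul_cancel₀ hq, one_mul, one_mul,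
    ← map_add, ← add_mul, h.add_eq, one_mul]

end CornerExp

/-! ### Diagonal matrices and averaging over level sets. -/

section Diag

variable {ι : Type*} [Fintype ι] [DecidableEq ι]

/-- The diagonal matrices whose entries lie in `S` and depend only on the value of `lam`. -/
def diagSubalgebra (lam : ι → ℝ) (S : StarSubalgebra ℂ A) :
    StarSubalgebra ℂ (Matrix ι ι A) where
  carrier := {Y | ∃ d : ℝ → A, (∀ ρ, d ρ ∈ S) ∧ Y = Matrix.diagonal fun s => d (lam s)}
  mul_mem' := by
    rintro _ _ ⟨d, hd, rfl⟩ ⟨d', hd', rfl⟩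
    exact ⟨fun ρ => d ρ * d' ρ, fun ρ => mul_mem (hd ρ) (hd' ρ), Matrix.diagonal_mul_diagonal _ _⟩
  add_mem' := by
    rintro _ _ ⟨d, hd, rfl⟩ ⟨d', hd', rfl⟩
    exact ⟨fun ρ => d ρ + d' ρ, fun ρ => add_mem (hd ρ) (hd' ρ), Matrix.diagonal_add _ _⟩
  algebraMap_mem' r := ⟨fun _ => algebraMap ℂ A r, fun _ => S.algebraMap_mem r, rfl⟩
  star_mem' := by
    rintro _ ⟨d, hd, rfl⟩
    exact ⟨fun ρ => star (d ρ), fun ρ => star_mem (hd ρ), Matrix.diagonal_conjTranspose _⟩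

theorem diagSubalgebra_mono (lam : ι → ℝ) {S T : StarSubalgebra ℂ A} (h : S ≤ T) :
    diagSubalgebra lam S ≤ diagSubalgebra lam T := by
  rintro _ ⟨d, hd, rfl⟩
  exact ⟨d, fun ρ => h (hd ρ), rfl⟩

/-- Apply `ψ` to the diagonal entries and average over the level sets of `lam`. -/
def diagAvg (lam : ι → ℝ) (ψ : A →ₗ[ℂ] A) : Matrix ι ι A →ₗ[ℂ] Matrix ι ι A where
  toFun Y := Matrix.diagonal fun s =>
    ((Finset.univ.filter fun t => lam t = lam s).card : ℂ)⁻¹ •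
      ∑ t with lam t = lam s, ψ (Y t t)
  map_add' X Y := by
    rw [Matrix.diagonal_add]
    simp only [Matrix.add_apply, map_add, Finset.sum_add_distrib, smul_add]
  map_smul' c X := by
    rw [RingHom.id_apply, ← Matrix.diagonal_smul]
    congr 1
    funext s
    simp only [Matrix.smul_apply, map_smul, ← Finset.smul_sum, Pi.smul_apply]
    rw [smul_comm]

theorem diagAvg_apply (lam : ι → ℝ) (ψ : A →ₗ[ℂ] A) (Y : Matrix ι ι A) :
    diagAvg lam ψ Y = Matrix.diagonal fun s =>
      ((Finset.univ.filter fun t => lam t = lam s).card : ℂ)⁻¹ •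
        ∑ t with lam t = lam s, ψ (Y t t) := rfl

theorem card_level_ne_zero (lam : ι → ℝ) (s : ι) :
    ((Finset.univ.filter fun t => lam t = lam s).card : ℂ) ≠ 0 := by
  rw [Nat.cast_ne_zero]
  exact (Finset.card_pos.2 ⟨s, by simp⟩).ne'

theorem avg_eq (lam : ι → ℝ) (s : ι) {g : ι → A} (hg : ∀ t, lam t = lam s → g t = g s) :
    ((Finset.univ.filter fun t => lam t = lam s).card : ℂ)⁻¹ • ∑ t with lam t = lam s, g t =
      g s := by
  rw [Finset.sum_congr rfl fun t ht => hg t (Finset.mem_filter.1 ht).2, Finset.sum_const,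
    ← Nat.cast_smul_eq_nsmul ℂ, smul_smul, inv_mul_cancel₀ (card_level_ne_zero lam s), one_smul]

/-- If the diagonal of `ψ(Y)` is constant on the level sets of `lam`, and `ψ` kills the entries
off the diagonal, then averaging amounts to applying `ψ` entrywise. -/
theorem diagAvg_eq_map {lam : ι → ℝ} {ψ : A →ₗ[ℂ] A} {Y : Matrix ι ι A}
    (h0 : ∀ s t, s ≠ t → ψ (Y s t) = 0)
    (h1 : ∀ s t, lam t = lam s → ψ (Y t t) = ψ (Y s s)) : diagAvg lam ψ Y = Y.map ψ := by
  ext s t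
  rw [diagAvg_apply, Matrix.map_apply]
  rcases eq_or_ne s t with rfl | hst
  · rw [Matrix.diagonal_apply_eq]
    exact avg_eq lam s (g := fun t => ψ (Y t t)) fun t ht => h1 s t ht
  · rw [Matrix.diagonal_apply_ne _ hst, h0 s t hst]

theorem diagAvg_of_mem_diagSubalgebra {lam : ι → ℝ} (ψ : A →ₗ[ℂ] A) {S : StarSubalgebra ℂ A}
    {Y : Matrix ι ι A} (hY : Y ∈ diagSubalgebra lam S) : diagAvg lam ψ Y = Y.map ψ := by
  obtain ⟨d, -, rfl⟩ := hY
  refine diagAvg_eq_map (fun s t hst => ?_) fun s t hst => ?_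
  · rw [Matrix.diagonal_apply_ne _ hst, map_zero]
  · simp only [Matrix.diagonal_apply_eq, hst]

/-- After exchanging the sums, `g t` occurs once for each `s` in the level set of `t`, and the
weights of these occurrences add up to 1. -/
theorem sum_avg (lam : ι → ℝ) (g : ι → ℂ) :
    ∑ s, ((Finset.univ.filter fun t => lam t = lam s).card : ℂ)⁻¹ * ∑ t with lam t = lam s, g t =
      ∑ s, g s := by
  simp only [Finset.mul_sum, Finset.sum_filter]
  rw [Finset.sum_comm]
  refine Finset.sum_congr rfl fun t _ => ?_
  simp only [mul_ite, mul_zero]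
  rw [← Finset.sum_filter, Finset.filter_congr (q := fun s => lam s = lam t)
    fun s _ => eq_comm,
    Finset.sum_congr rfl (g := fun _ =>
      ((Finset.univ.filter fun s => lam s = lam t).card : ℂ)⁻¹ * g t) fun s hs => by
        rw [(Finset.mem_filter.1 hs).2],
    Finset.sum_const, nsmul_eq_mul, ← mul_assoc, mul_inv_cancel₀ (card_level_ne_zero lam t),
    one_mul]

section CornerAvg

variable {lam : ι → ℝ} {τ : A →ₗ[ℂ] ℂ} {p q : A}

theorem diagAvg_mem (h : IsComplProj p q) (Y : Matrix ι ι A) :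
    diagAvg lam (cornerExp τ p q) Y ∈
      diagSubalgebra lam (StarAlgebra.adjoin ℂ {p, q}) :=
  ⟨fun ρ => ((Finset.univ.filter fun t => lam t = ρ).card : ℂ)⁻¹ •
      ∑ t with lam t = ρ, cornerExp τ p q (Y t t),
    fun _ => SMulMemClass.smul_mem _ (sum_mem fun _ _ => cornerExp_mem h _), rfl⟩

theorem diagAvg_bimodule (h : IsComplProj p q) {b b' : Matrix ι ι A}
    (hb : b ∈ diagSubalgebra lam (StarAlgebra.adjoin ℂ {p, q}))
    (hb' : b' ∈ diagSubalgebra lam (StarAlgebra.adjoin ℂ {p, q})) (Y : Matrix ι ι A) :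
    diagAvg lam (cornerExp τ p q) (b * Y * b') = b * diagAvg lam (cornerExp τ p q) Y * b' := by
  obtain ⟨d, hd, rfl⟩ := hb
  obtain ⟨d', hd', rfl⟩ := hb'
  rw [diagAvg_apply, diagAvg_apply, Matrix.diagonal_mul_diagonal, Matrix.diagonal_mul_diagonal]
  congr 1
  funext s
  rw [mul_smul_comm, smul_mul_assoc, Finset.mul_sum, Finset.sum_mul]
  congr 1
  refine Finset.sum_congr rfl fun t ht => ?_
  rw [Matrix.mul_diagonal, Matrix.diagonal_mul, cornerExp_bimodule h (hd _) (hd' _),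
    (Finset.mem_filter.1 ht).2]

theorem diagAvg_one (h : IsComplProj p q) (hp : τ p ≠ 0) (hq : τ q ≠ 0) :
    diagAvg lam (cornerExp τ p q) (1 : Matrix ι ι A) = 1 := by
  rw [diagAvg_of_mem_diagSubalgebra (S := ⊤) _ (one_mem _)]
  exact Matrix.map_one _ (map_zero _) (cornerExp_one h hp hq)

theorem sum_trace_diagAvg (hτ : IsTracialState τ) (h : IsComplProj p q) (hp : τ p ≠ 0)
    (hq : τ q ≠ 0) (Y : Matrix ι ι A) :
    ∑ s, τ (diagAvg lam (cornerExp τ p q) Y s s) = ∑ s, τ (Y s s) := by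
  simp only [diagAvg_apply, Matrix.diagonal_apply_eq, map_smul, map_sum, smul_eq_mul,
    trace_cornerExp hτ h hp hq]
  exact sum_avg lam fun t => τ (Y t t)

/-- Faithfulness of the trace on the image of `B`, the source of uniqueness. On the span of `p` and
`q` it needs only that `τ p` and `τ q` are nonnegative and nonzero. -/
theorem eq_zero_of_sum_trace_star_mul_eq_zero (hτ : IsTracialState τ) (h : IsComplProj p q)
    (hp : τ p ≠ 0) (hq : τ q ≠ 0) {Y : Matrix ι ι A}
    (hY : Y ∈ diagSubalgebra lam (StarAlgebra.adjoin ℂ {p, q}))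
    (h0 : ∑ s, τ ((star Y * Y) s s) = 0) : Y = 0 := by
  obtain ⟨d, hd, rfl⟩ := hY
  have hp0 : 0 ≤ τ p := by simpa [h.star_eq, h.idem] using hτ.nonneg p
  have hq0 : 0 ≤ τ q := by simpa [h.star_eq', h.idem'] using hτ.nonneg q
  have hs : ∀ s, τ (star (d (lam s)) * d (lam s)) = 0 := by
    have := (Finset.sum_eq_zero_iff_of_nonneg fun s _ => hτ.nonneg (d (lam s))).1
      (by simpa [Matrix.star_eq_conjTranspose, Matrix.diagonal_conjTranspose] using h0)
    exact fun s => this s (Finset.mem_univ s)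
  rw [Matrix.diagonal_eq_zero]
  funext s
  obtain ⟨α, β, hαβ⟩ := h.mem_adjoin_iff.1 (hd (lam s))
  have := hs s
  rw [hαβ, h.star_comb, h.comb_mul, map_add, map_smul, map_smul, smul_eq_mul, smul_eq_mul,
    add_eq_zero_iff_of_nonneg (mul_nonneg (star_mul_self_nonneg α) hp0)
      (mul_nonneg (star_mul_self_nonneg β) hq0)] at this
  have hα : α = 0 := by simpa [hp] using this.1
  have hβ : β = 0 := by simpa [hq] using this.2
  simp [hαβ, hα, hβ]

end CornerAvg

end Diag

end

/-! ### Matrices with entries `w_s^* h w_t`. -/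

section

variable {A : Type*} [Ring A] [StarRing A] [Algebra ℂ A] [StarModule ℂ A]

section Sandwich

variable {ι : Type*} [Fintype ι] [DecidableEq ι]

/-- The sum of the `w_s w_s^*` over a level set of `lam`. -/
def levelSum (lam : ι → ℝ) (w : ι → A) (ρ : ℝ) : A :=
  ∑ s with lam s = ρ, w s * star (w s)

theorem star_levelSum (lam : ι → ℝ) (w : ι → A) (ρ : ℝ) :
    star (levelSum lam w ρ) = levelSum lam w ρ := by
  simp [levelSum]

/-- The `*`-algebra generated by the level sums at the nonzero values of `lam`. -/
def levelAlg (lam : ι → ℝ) (w : ι → A) : StarSubalgebra ℂ A :=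
  StarAlgebra.adjoin ℂ (levelSum lam w '' {ρ | ρ ≠ 0 ∧ ∃ s, lam s = ρ})

/-- The generators are self-adjoint, so the `*`-algebra is the linear span of words in them. This
extends trace identities known on words to the whole algebra. -/
theorem levelAlg_induction {lam : ι → ℝ} {w : ι → A} {P : A → Prop} (hzero : P 0)
    (hadd : ∀ a b, P a → P b → P (a + b)) (hsmul : ∀ (c : ℂ) a, P a → P (c • a))
    (hprod : ∀ L : List ℝ, (∀ ρ ∈ L, ρ ≠ 0 ∧ ∃ s, lam s = ρ) →
      P (L.map (levelSum lam w)).prod) {a : A} (ha : a ∈ levelAlg lam w) : P a := by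
  have hstar : star (levelSum lam w '' {ρ | ρ ≠ 0 ∧ ∃ s, lam s = ρ}) =
      levelSum lam w '' {ρ | ρ ≠ 0 ∧ ∃ s, lam s = ρ} := by
    ext a
    rw [Set.mem_star]
    constructor
    · rintro ⟨ρ, hρ, h⟩
      exact ⟨ρ, hρ, by rw [← star_star a, ← h, star_levelSum]⟩
    · rintro ⟨ρ, hρ, rfl⟩
      exact ⟨ρ, hρ, (star_levelSum lam w ρ).symm⟩
  rw [levelAlg, ← StarSubalgebra.mem_toSubalgebra, StarAlgebra.adjoin_toSubalgebra, hstar,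
    Set.union_self, ← Subalgebra.mem_toSubmodule, Algebra.adjoin_eq_span] at ha
  induction ha using Submodule.span_induction with
  | mem x hx =>
    obtain ⟨l, hl, rfl⟩ := Submonoid.exists_list_of_mem_closure hx
    obtain ⟨L, hL⟩ : ∃ L : List ℝ, (∀ ρ ∈ L, ρ ≠ 0 ∧ ∃ s, lam s = ρ) ∧
        L.map (levelSum lam w) = l := by
      clear hx
      induction l with
      | nil => exact ⟨[], by simp⟩
      | cons a l ih =>
        obtain ⟨ρ, hρ, rfl⟩ := hl a (by simp)
        obtain ⟨L, hL, rfl⟩ := ih fun y hy => hl y (by simp [hy])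
        exact ⟨ρ :: L, by simpa using ⟨hρ, hL⟩, rfl⟩
    rw [← hL.2]
    exact hprod L hL.1
  | zero => exact hzero
  | add x y _ _ hx hy => exact hadd x y hx hy
  | smul c x _ hx => exact hsmul c x hx

variable {lam : ι → ℝ} {w : ι → A} {p q : A}

/-- Since `h` and `h'` see `t` only through `lam t`, grouping the sum by eigenvalue assembles the
inner factors `w t * star (w t)` into level sums. This is why sandwich matrices are closed under
multiplication. -/
theorem sum_sandwich_mul (lam : ι → ℝ) (w : ι → A) (h h' : ℝ → ℝ → A) (s u : ι) :
    ∑ t, star (w s) * h (lam s) (lam t) * w t * (star (w t) * h' (lam t) (lam u) * w u) =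
      star (w s) * (∑ μ ∈ Finset.univ.image lam,
        h (lam s) μ * levelSum lam w μ * h' μ (lam u)) * w u := by
  rw [← Finset.sum_fiberwise_of_maps_to (g := lam) (t := Finset.univ.image lam)
    fun t _ => Finset.mem_image_of_mem _ (Finset.mem_univ t), Finset.mul_sum, Finset.sum_mul]
  refine Finset.sum_congr rfl fun μ _ => ?_
  rw [levelSum, Finset.mul_sum, Finset.sum_mul, Finset.mul_sum, Finset.sum_mul]
  refine Finset.sum_congr rfl fun t ht => ?_
  rw [(Finset.mem_filter.1 ht).2]
  simp only [mul_assoc]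

/-- The matrices with entries `w_s^* h(lam s, lam t) w_t`, plus a diagonal matrix with entries in
`⟨p, q⟩`. -/
def sandwichSubalgebra (hpq : IsComplProj p q) (lam : ι → ℝ) {w : ι → A}
    (hw : ∀ s, w s * p = w s) : StarSubalgebra ℂ (Matrix ι ι A) where
  carrier := {Y | ∃ (α β : ℝ → ℂ) (h : ℝ → ℝ → A), (∀ ρ σ, h ρ σ ∈ levelAlg lam w) ∧
    (∀ σ, h 0 σ = 0) ∧ (∀ ρ, h ρ 0 = 0) ∧
    Y = Matrix.diagonal (fun s => α (lam s) • p + β (lam s) • q) +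
      Matrix.of fun s t => star (w s) * h (lam s) (lam t) * w t}
  mul_mem' := by
    rintro _ _ ⟨α, β, h, hh, hl, hr, rfl⟩ ⟨α', β', h', hh', hl', hr', rfl⟩
    have hwq : ∀ s, w s * q = 0 := fun s => by
      rw [← hw s, mul_assoc, hpq.mul_right, mul_zero]
    have hpw : ∀ s, p * star (w s) = star (w s) := fun s => by
      conv_rhs => rw [← hw s, star_mul, hpq.star_eq]
    have hqw : ∀ s, q * star (w s) = 0 := fun s => by
      rw [← hpq.star_eq', ← star_mul, hwq, star_zero]
    -- As `p` fixes `star (w s)` and `q` kills it, the diagonal factors act on the sandwich terms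
    -- through their `p`-coefficients only. The sum over `μ` comes from the product of the two
    -- sandwich terms.
    refine ⟨fun ρ => α ρ * α' ρ, fun ρ => β ρ * β' ρ, fun ρ σ => α ρ • h' ρ σ + α' σ • h ρ σ +
      ∑ μ ∈ Finset.univ.image lam, h ρ μ * levelSum lam w μ * h' μ σ, fun ρ σ => ?_,
      fun σ => ?_, fun ρ => ?_, ?_⟩
    · refine add_mem (add_mem (SMulMemClass.smul_mem _ (hh' _ _))
        (SMulMemClass.smul_mem _ (hh _ _))) (sum_mem fun μ hμ => ?_)
      -- The level sum at eigenvalue 0 is not among the generators of `levelAlg`; the vanishing of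
      -- `h` at 0 removes that term.
      rcases eq_or_ne μ 0 with rfl | hμ0
      · rw [hr, zero_mul, zero_mul]
        exact zero_mem _
      · obtain ⟨s, -, hs⟩ := Finset.mem_image.1 hμ
        exact mul_mem (mul_mem (hh _ _)
          (StarAlgebra.subset_adjoin _ _ ⟨μ, ⟨hμ0, s, hs⟩, rfl⟩)) (hh' _ _)
    · simp [hl, hl']
    · simp [hr, hr']
    · rw [add_mul, mul_add, mul_add, Matrix.diagonal_mul_diagonal, add_assoc]
      simp only [hpq.comb_mul]
      congr 1
      ext s u
      rw [Matrix.add_apply, Matrix.add_apply, Matrix.diagonal_mul, Matrix.mul_diagonal,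
        Matrix.mul_apply]
      simp only [Matrix.of_apply]
      rw [sum_sandwich_mul]
      simp only [mul_add, add_mul, mul_smul_comm, smul_mul_assoc]
      rw [← mul_assoc p, ← mul_assoc p, hpw, ← mul_assoc q, ← mul_assoc q, hqw,
        mul_assoc _ (w u) p, hw, mul_assoc _ (w u) q, hwq]
      simp only [zero_mul, mul_zero, smul_zero, add_zero]
      abel
  add_mem' := by
    rintro _ _ ⟨α, β, h, hh, hl, hr, rfl⟩ ⟨α', β', h', hh', hl', hr', rfl⟩
    refine ⟨fun ρ => α ρ + α' ρ, fun ρ => β ρ + β' ρ, fun ρ σ => h ρ σ + h' ρ σ,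
      fun ρ σ => add_mem (hh _ _) (hh' _ _), by simp [hl, hl'], by simp [hr, hr'], ?_⟩
    rw [add_add_add_comm, Matrix.diagonal_add]
    congr 1
    · congr 1
      funext s
      simp only [add_smul]
      abel
    · ext s t
      simp [mul_add, add_mul]
  algebraMap_mem' r := by
    refine ⟨fun _ => r, fun _ => r, fun _ _ => 0, fun _ _ => zero_mem _, fun _ => rfl,
      fun _ => rfl, ?_⟩
    simp only [← hpq.algebraMap_eq, mul_zero, zero_mul]
    exact (add_zero _).symm
  star_mem' := by
    rintro _ ⟨α, β, h, hh, hl, hr, rfl⟩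
    refine ⟨fun ρ => star (α ρ), fun ρ => star (β ρ), fun ρ σ => star (h σ ρ),
      fun ρ σ => star_mem (hh _ _), by simp [hr], by simp [hl], ?_⟩
    rw [star_add]
    congr 1
    · rw [Matrix.star_eq_conjTranspose, Matrix.diagonal_conjTranspose]
      congr 1
      funext s
      exact hpq.star_comb _ _
    · ext s t
      simp [Matrix.star_apply, mul_assoc]

variable {τ : A →ₗ[ℂ] ℂ}

/-- By traciality, `ψ` of an entry `w_s^* h w_t` is a multiple of `τ(w_t w_s^* h)`, which is exactly
the quantity controlled by `htw`: it vanishes off the diagonal, and on it depends only on the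
eigenvalue. -/
theorem diagAvg_of_mem_sandwichSubalgebra (hτ : IsTracialState τ) (hpq : IsComplProj p q)
    (hw : ∀ s, w s * p = w s)
    (htw : ∀ L : List ℝ, (∀ ρ ∈ L, ρ ≠ 0 ∧ ∃ s, lam s = ρ) → ∀ j₁ j₁' j₂ : ι, lam j₁ ≠ 0 →
      lam j₁' = lam j₁ → τ (w j₁ * star (w j₂) * (L.map (levelSum lam w)).prod) =
        if j₁ = j₂ then τ (w j₁' * star (w j₁') * (L.map (levelSum lam w)).prod) else 0)
    {Y : Matrix ι ι A} (hY : Y ∈ sandwichSubalgebra hpq lam hw) :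
    diagAvg lam (cornerExp τ p q) Y = Y.map (cornerExp τ p q) := by
  obtain ⟨α, β, h, hh, hl, hr, rfl⟩ := hY
  have hqw : ∀ s, q * star (w s) = 0 := fun s => by
    rw [← hpq.star_eq', ← star_mul, ← hw s, mul_assoc, hpq.mul_right, mul_zero, star_zero]
  have hψ : ∀ (a : A) s t, cornerExp τ p q (star (w s) * a * w t) =
      ((τ p)⁻¹ * τ (w t * star (w s) * a)) • p := by
    intro a s t
    rw [cornerExp_apply, mul_assoc _ _ p, mul_assoc _ (w t) p, hw, ← mul_assoc q, ← mul_assoc q,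
      hqw, zero_mul, zero_mul, zero_mul, map_zero, mul_zero, zero_smul, add_zero, ← mul_assoc,
      ← mul_assoc, hτ.trace, ← mul_assoc, ← mul_assoc, hw]
  have htw' : ∀ a ∈ levelAlg lam w, ∀ j₁ j₁' j₂ : ι, lam j₁ ≠ 0 → lam j₁' = lam j₁ →
      τ (w j₁ * star (w j₂) * a) = if j₁ = j₂ then τ (w j₁' * star (w j₁') * a) else 0 := by
    intro a ha j₁ j₁' j₂ h0 h1
    refine levelAlg_induction (P := fun a => τ (w j₁ * star (w j₂) * a) =
      if j₁ = j₂ then τ (w j₁' * star (w j₁') * a) else 0) (by simp) (fun a b ha hb => ?_)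
      (fun c a ha => ?_) (fun L hL => htw L hL j₁ j₁' j₂ h0 h1) ha
    · rw [mul_add, mul_add, map_add, map_add, ha, hb]
      split_ifs <;> simp
    · rw [mul_smul_comm, mul_smul_comm, map_smul, map_smul, ha]
      split_ifs <;> simp
  refine diagAvg_eq_map (fun s t hst => ?_) fun s t hst => ?_
  · rw [Matrix.add_apply, Matrix.diagonal_apply_ne _ hst, zero_add, Matrix.of_apply]
    -- The trace condition covers nonzero eigenvalues only; at eigenvalue 0 the sandwich entry
    -- itself vanishes.
    by_cases h0 : lam t = 0
    · rw [h0, hr, mul_zero, zero_mul, map_zero]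
    · rw [hψ, htw' _ (hh _ _) t t s h0 rfl, if_neg hst.symm, mul_zero, zero_smul]
  · simp only [Matrix.add_apply, Matrix.diagonal_apply_eq, Matrix.of_apply, map_add, hst]
    congr 1
    by_cases h0 : lam s = 0
    · simp [h0, hr]
    · rw [hψ, hψ, htw' _ (hh _ _) t s t (hst ▸ h0) hst.symm, if_pos rfl]

end Sandwich

/-! ### Entries of alternating products. -/

section Words

variable {ι I : Type*} [Fintype ι] [DecidableEq ι]

/-- The entries of a product of matrices are sums of products of entries, one from each factor. -/
theorem list_prod_apply_mem_span (P : I → A → Prop) (l : List (I × Matrix ι ι A))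
    (hl : ∀ z ∈ l, ∀ s t, P z.1 (z.2 s t)) (s u : ι) :
    (l.map Prod.snd).prod s u ∈ Submodule.span ℂ {a | ∃ k : List (I × A),
      k.map Prod.fst = l.map Prod.fst ∧ (∀ z ∈ k, P z.1 z.2) ∧ a = (k.map Prod.snd).prod} := by
  induction l generalizing s with
  | nil =>
    change (1 : Matrix ι ι A) s u ∈ _
    rw [Matrix.one_apply]
    split_ifs
    · exact Submodule.subset_span ⟨[], by simp⟩
    · exact zero_mem _
  | cons z l ih =>
    change (z.2 * (l.map Prod.snd).prod : Matrix ι ι A) s u ∈ _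
    rw [Matrix.mul_apply]
    refine sum_mem fun t _ => ?_
    have hz := hl z (by simp) s t
    -- Left multiplication by the entry `z.2 s t` is linear, so it suffices to prepend this letter
    -- to a single word for the tail.
    refine (Submodule.span_le (p := (Submodule.span ℂ _).comap
      (LinearMap.mulLeft ℂ (z.2 s t)))).2 ?_ (ih (fun y hy => hl y (by simp [hy])) t)
    rintro _ ⟨k, hk, hkP, rfl⟩
    refine Submodule.subset_span ⟨(z.1, z.2 s t) :: k, by simp [hk], ?_, by simp⟩
    intro y hy
    rcases List.mem_cons.1 hy with rfl | hy
    exacts [hz, hkP y hy]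

/-- Products of matrices with centred entries have centred entries, if neighbouring factors
have their entries in different members of a free family. -/
theorem FreeOver.map_list_prod_apply {B : StarSubalgebra ℂ A} {ψ : A →ₗ[ℂ] A} {S : I → Set A}
    (h : FreeOver B ψ S) (l : List (I × Matrix ι ι A)) (hne : l ≠ [])
    (hc : (l.map Prod.fst).IsChain (· ≠ ·))
    (hl : ∀ z ∈ l, ∀ s t, z.2 s t ∈ StarAlgebra.adjoin ℂ (S z.1 ∪ (B : Set A)) ∧
      ψ (z.2 s t) = 0) (s u : ι) : ψ ((l.map Prod.snd).prod s u) = 0 := by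
  refine (Submodule.span_le (p := LinearMap.ker ψ)).2 ?_ (list_prod_apply_mem_span
    (fun i a => a ∈ StarAlgebra.adjoin ℂ (S i ∪ (B : Set A)) ∧ ψ a = 0) l hl s u)
  rintro _ ⟨k, hk, hkP, rfl⟩
  have hmap : k.map Prod.snd = k.map fun z => z.2 - ψ z.2 :=
    List.map_congr_left fun z hz => by rw [(hkP z hz).2, sub_zero]
  rw [SetLike.mem_coe, LinearMap.mem_ker, hmap]
  refine h k ?_ (hk ▸ hc) fun z hz => (hkP z hz).1
  rintro rfl
  exact hne (by simpa using hk.symm)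

end Words

end

/-! ### Passing to an eigenbasis; existence and uniqueness of the expectation. -/

section

variable {A : Type*} [Ring A] [StarRing A] [Algebra ℂ A] [StarModule ℂ A]

section ChangeOfBasis

variable {κ ι : Type*} [Fintype κ] [DecidableEq κ] [Fintype ι] [DecidableEq ι]

/-- Conjugation by a rectangular unitary matrix. -/
def conjUnitary (u : Matrix κ ι A) (h₁ : u.conjTranspose * u = 1)
    (h₂ : u * u.conjTranspose = 1) :
    Matrix κ κ A ≃⋆ₐ[ℂ] Matrix ι ι A where
  toFun X := u.conjTranspose * X * u
  invFun Y := u * Y * u.conjTranspose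
  left_inv X := by
    dsimp only
    rw [← Matrix.mul_assoc, ← Matrix.mul_assoc, h₂, Matrix.one_mul, Matrix.mul_assoc, h₂,
      Matrix.mul_one]
  right_inv Y := by
    dsimp only
    rw [← Matrix.mul_assoc, ← Matrix.mul_assoc, h₁, Matrix.one_mul, Matrix.mul_assoc, h₁,
      Matrix.mul_one]
  map_mul' X Y := by
    rw [Matrix.mul_assoc (u.conjTranspose * X), ← Matrix.mul_assoc u, ← Matrix.mul_assoc u, h₂,
      Matrix.one_mul]
    simp only [Matrix.mul_assoc]
  map_add' X Y := by rw [Matrix.mul_add, Matrix.add_mul]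
  map_star' X := by
    simp only [Matrix.star_eq_conjTranspose, Matrix.conjTranspose_mul,
      Matrix.conjTranspose_conjTranspose, Matrix.mul_assoc]
  map_smul' c X := by rw [Matrix.mul_smul, Matrix.smul_mul]

/-- The matrix of scalars in `A` whose columns are the vectors of an orthonormal basis. -/
def basisMatrix (A : Type*) [Ring A] [Algebra ℂ A]
    (v : OrthonormalBasis ι ℂ (EuclideanSpace ℂ κ)) : Matrix κ ι A :=
  Matrix.of fun a s => algebraMap ℂ A (v s a)

theorem basisMatrix_eq_map (v : OrthonormalBasis ι ℂ (EuclideanSpace ℂ κ)) :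
    basisMatrix A v = (Matrix.of fun a s => v s a : Matrix κ ι ℂ).map (algebraMap ℂ A) := rfl

theorem conjTranspose_basisMatrix (v : OrthonormalBasis ι ℂ (EuclideanSpace ℂ κ)) :
    (basisMatrix A v).conjTranspose =
      ((Matrix.of fun a s => v s a : Matrix κ ι ℂ).conjTranspose).map (algebraMap ℂ A) := by
  ext s a
  exact (algebraMap_star_comm _).symm

theorem conjTranspose_mul_self_of_orthonormalBasis
    (v : OrthonormalBasis ι ℂ (EuclideanSpace ℂ κ)) :
    (Matrix.of fun a s => v s a : Matrix κ ι ℂ).conjTranspose * Matrix.of (fun a s => v s a) =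
      1 := by
  ext s t
  have := orthonormal_iff_ite.1 v.orthonormal s t
  rw [PiLp.inner_apply] at this
  simp only [RCLike.inner_apply] at this
  simpa [Matrix.mul_apply, Matrix.one_apply, mul_comm] using this

theorem mul_conjTranspose_self_of_orthonormalBasis
    (v : OrthonormalBasis ι ℂ (EuclideanSpace ℂ κ)) :
    (Matrix.of fun a s => v s a : Matrix κ ι ℂ) * (Matrix.of fun a s => v s a).conjTranspose =
      1 := by
  -- A one-sided inverse is two-sided because both index types count the dimension of the space.
  refine (Matrix.mul_eq_one_comm_of_card_eq _ _ _ ?_).1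
    (conjTranspose_mul_self_of_orthonormalBasis v)
  rw [← Module.finrank_eq_card_basis v.toBasis, finrank_euclideanSpace]

theorem conjTranspose_basisMatrix_mul_self (v : OrthonormalBasis ι ℂ (EuclideanSpace ℂ κ)) :
    (basisMatrix A v).conjTranspose * basisMatrix A v = 1 := by
  rw [conjTranspose_basisMatrix, basisMatrix_eq_map, ← Matrix.map_mul,
    conjTranspose_mul_self_of_orthonormalBasis, Matrix.map_one _ (map_zero _) (map_one _)]

theorem basisMatrix_mul_conjTranspose_self (v : OrthonormalBasis ι ℂ (EuclideanSpace ℂ κ)) :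
    basisMatrix A v * (basisMatrix A v).conjTranspose = 1 := by
  rw [conjTranspose_basisMatrix, basisMatrix_eq_map, ← Matrix.map_mul,
    mul_conjTranspose_self_of_orthonormalBasis, Matrix.map_one _ (map_zero _) (map_one _)]

/-- The matrix of `X` in the orthonormal basis `v`. -/
def inBasis (A : Type*) [Ring A] [StarRing A] [Algebra ℂ A] [StarModule ℂ A]
    (v : OrthonormalBasis ι ℂ (EuclideanSpace ℂ κ)) : Matrix κ κ A ≃⋆ₐ[ℂ] Matrix ι ι A :=
  conjUnitary (basisMatrix A v) (conjTranspose_basisMatrix_mul_self v)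
    (basisMatrix_mul_conjTranspose_self v)

variable (v : OrthonormalBasis ι ℂ (EuclideanSpace ℂ κ))

theorem inBasis_apply (X : Matrix κ κ A) :
    inBasis A v X = (basisMatrix A v).conjTranspose * X * basisMatrix A v := rfl

theorem inBasis_tensor {C : Matrix κ κ ℂ} {μ : ι → ℂ}
    (hC : ∀ s, C.mulVec (v s) = fun a => μ s * v s a) (a : A) :
    inBasis A v (tensor a C) = Matrix.diagonal fun s => μ s • a := by
  have : tensor a C * basisMatrix A v = basisMatrix A v * Matrix.diagonal fun s => μ s • a := by
    ext b s
    rw [Matrix.mul_diagonal, Matrix.mul_apply]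
    have := congrFun (hC s) b
    simp only [Matrix.mulVec, dotProduct] at this
    simp only [basisMatrix, tensor, Matrix.map_apply, Matrix.of_apply,
      Algebra.algebraMap_eq_smul_one, smul_mul_smul_comm, mul_one, one_mul, ← Finset.sum_smul,
      this]
    rw [mul_comm]
  rw [inBasis_apply, Matrix.mul_assoc, this, ← Matrix.mul_assoc,
    conjTranspose_basisMatrix_mul_self, Matrix.one_mul]

theorem inBasis_tensor_one (a : A) :
    inBasis A v (tensor a 1) = Matrix.diagonal fun _ => a := by
  rw [inBasis_tensor v (μ := fun _ => 1) (by simp)]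
  simp

theorem sum_trace_mul_comm {τ : A →ₗ[ℂ] ℂ} (hτ : IsTracialState τ) (M : Matrix ι κ A)
    (N : Matrix κ ι A) : ∑ s, τ ((M * N) s s) = ∑ a, τ ((N * M) a a) := by
  simp only [Matrix.mul_apply, map_sum]
  rw [Finset.sum_comm]
  exact Finset.sum_congr rfl fun a _ => Finset.sum_congr rfl fun s _ => hτ.trace _ _

theorem sum_trace_inBasis {τ : A →ₗ[ℂ] ℂ} (hτ : IsTracialState τ) (X : Matrix κ κ A) :
    ∑ s, τ (inBasis A v X s s) = ∑ a, τ (X a a) := by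
  rw [inBasis_apply, sum_trace_mul_comm hτ, ← Matrix.mul_assoc,
    basisMatrix_mul_conjTranspose_self, Matrix.one_mul]

theorem tensorTrace_eq {τ : A →ₗ[ℂ] ℂ} (hτ : IsTracialState τ) (X : Matrix κ κ A) :
    tensorTrace τ X = (Fintype.card κ : ℂ)⁻¹ * ∑ s, τ (inBasis A v X s s) := by
  rw [sum_trace_inBasis v hτ, tensorTrace]

theorem aeval_diagonal (d : ι → A) (P : Polynomial ℂ) :
    Polynomial.aeval (Matrix.diagonal d) P =
      Matrix.diagonal fun s => Polynomial.aeval (d s) P := by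
  have := Polynomial.aeval_algHom_apply (Matrix.diagonalAlgHom (n := ι) (α := A) ℂ) d P
  rw [Matrix.diagonalAlgHom_apply, Matrix.diagonalAlgHom_apply] at this
  rw [this]
  congr 1
  funext s
  exact (Polynomial.aeval_algHom_apply (Pi.evalAlgHom ℂ (fun _ : ι => A) s) d P).symm

/-- The algebra generated by `p ⊗ 1`, `q ⊗ 1` and `1 ⊗ C` consists, in an eigenbasis of `C`, of
the diagonal matrices with entries in `⟨p, q⟩` that depend only on the eigenvalue. -/
theorem mem_adjoin_tensor_iff {p q : A} (h : IsComplProj p q) {C : Matrix κ κ ℂ} {lam : ι → ℝ}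
    (hC : ∀ s, C.mulVec (v s) = fun a => (lam s : ℂ) * v s a) {X : Matrix κ κ A} :
    X ∈ StarAlgebra.adjoin ℂ {tensor p 1, tensor q 1, tensor 1 C} ↔
      inBasis A v X ∈ diagSubalgebra lam (StarAlgebra.adjoin ℂ {p, q}) := by
  constructor
  · suffices StarAlgebra.adjoin ℂ {tensor p 1, tensor q 1, tensor 1 C} ≤
        (diagSubalgebra lam (StarAlgebra.adjoin ℂ {p, q})).comap
          (inBasis A v : Matrix κ κ A →⋆ₐ[ℂ] Matrix ι ι A) from fun hX => this hX
    refine StarAlgebra.adjoin_le ?_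
    rintro _ (rfl | rfl | rfl)
    · exact ⟨fun _ => p, fun _ => StarAlgebra.subset_adjoin _ _ (by simp),
        inBasis_tensor_one v p⟩
    · exact ⟨fun _ => q, fun _ => StarAlgebra.subset_adjoin _ _ (by simp),
        inBasis_tensor_one v q⟩
    · exact ⟨fun ρ => (ρ : ℂ) • 1, fun ρ => SMulMemClass.smul_mem _ (one_mem _),
        inBasis_tensor v hC 1⟩
  · rintro ⟨d, hd, hX⟩
    choose α β hαβ using fun ρ => h.mem_adjoin_iff.1 (hd ρ)
    -- Interpolation at the finitely many eigenvalues realizes any function of the eigenvalue as a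
    -- polynomial in `1 ⊗ C`.
    let P (g : ℝ → ℂ) : Polynomial ℂ :=
      Lagrange.interpolate (Finset.univ.image lam) (fun ρ : ℝ => (ρ : ℂ)) g
    have hP : ∀ g, inBasis A v (Polynomial.aeval (tensor 1 C) (P g)) =
        Matrix.diagonal fun s => algebraMap ℂ A (g (lam s)) := by
      intro g
      rw [← Polynomial.aeval_algHom_apply (inBasis A v), inBasis_tensor v hC, aeval_diagonal]
      congr 1
      funext s
      rw [← Algebra.algebraMap_eq_smul_one, Polynomial.aeval_algebraMap_apply_eq_algebraMap_eval,
        Lagrange.eval_interpolate_at_node (v := fun ρ : ℝ => (ρ : ℂ)) g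
          Complex.ofReal_injective.injOn
          (Finset.mem_image_of_mem lam (Finset.mem_univ s))]
    have hXeq : X = tensor p 1 * Polynomial.aeval (tensor 1 C) (P α) +
        tensor q 1 * Polynomial.aeval (tensor 1 C) (P β) := by
      apply EquivLike.injective (inBasis A v)
      rw [hX, map_add, map_mul, map_mul, hP, hP, inBasis_tensor_one, inBasis_tensor_one,
        Matrix.diagonal_mul_diagonal, Matrix.diagonal_mul_diagonal, Matrix.diagonal_add]
      congr 1
      funext s
      rw [hαβ, ← Algebra.commutes, ← Algebra.commutes, Algebra.smul_def, Algebra.smul_def]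
    have hmem : ∀ g, Polynomial.aeval (tensor 1 C) (P g) ∈
        StarAlgebra.adjoin ℂ ({tensor p 1, tensor q 1, tensor 1 C} : Set (Matrix κ κ A)) :=
      fun g => by
        have := Polynomial.aeval_mem_adjoin_singleton ℂ (p := P g) (tensor (1 : A) C)
        exact Algebra.adjoin_le (S := (StarAlgebra.adjoin ℂ _).toSubalgebra)
          (Set.singleton_subset_iff.2 (StarAlgebra.subset_adjoin _ _ (by simp))) this
    rw [hXeq]
    exact add_mem (mul_mem (StarAlgebra.subset_adjoin _ _ (by simp)) (hmem α))
      (mul_mem (StarAlgebra.subset_adjoin _ _ (by simp)) (hmem β))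

/-- The conditional expectation: average `ψ` over the eigenspaces. -/
def basisExp (v : OrthonormalBasis ι ℂ (EuclideanSpace ℂ κ)) (lam : ι → ℝ) (ψ : A →ₗ[ℂ] A) :
    Matrix κ κ A →ₗ[ℂ] Matrix κ κ A where
  toFun X := (inBasis A v).symm (diagAvg lam ψ (inBasis A v X))
  map_add' X Y := by simp only [map_add]
  map_smul' c X := by simp only [map_smul, RingHom.id_apply]

theorem inBasis_basisExp (lam : ι → ℝ) (ψ : A →ₗ[ℂ] A) (X : Matrix κ κ A) :
    inBasis A v (basisExp v lam ψ X) = diagAvg lam ψ (inBasis A v X) :=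
  (inBasis A v).apply_symm_apply _

variable {v} {lam : ι → ℝ} {τ : A →ₗ[ℂ] ℂ} {p q : A} {C : Matrix κ κ ℂ}

theorem isCondExp_basisExp (h : IsComplProj p q) (hp : τ p ≠ 0) (hq : τ q ≠ 0)
    (hC : ∀ s, C.mulVec (v s) = fun a => (lam s : ℂ) * v s a) :
    IsCondExp (StarAlgebra.adjoin ℂ {tensor p 1, tensor q 1, tensor 1 C})
      (basisExp v lam (cornerExp τ p q)) where
  mem X := by
    rw [mem_adjoin_tensor_iff v h hC, inBasis_basisExp]
    exact diagAvg_mem h _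
  bimodule b hb b' hb' X := by
    rw [mem_adjoin_tensor_iff v h hC] at hb hb'
    apply EquivLike.injective (inBasis A v)
    simp only [map_mul, inBasis_basisExp]
    exact diagAvg_bimodule h hb hb' _
  map_one := by
    apply EquivLike.injective (inBasis A v)
    rw [inBasis_basisExp, map_one, diagAvg_one h hp hq]

theorem tensorTrace_basisExp (hτ : IsTracialState τ) (h : IsComplProj p q) (hp : τ p ≠ 0)
    (hq : τ q ≠ 0) (X : Matrix κ κ A) :
    tensorTrace τ (basisExp v lam (cornerExp τ p q) X) = tensorTrace τ X := by
  rw [tensorTrace_eq v hτ, tensorTrace_eq v hτ, inBasis_basisExp, sum_trace_diagAvg hτ h hp hq]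

/-- The difference `Z = E' X - E X` lies in `B`, so `Z^* Z` has trace `tr(E'(Z^* X)) - tr(E(Z^* X))
= 0`, and the trace is faithful on `B`. -/
theorem condExp_unique [Nonempty κ] (hτ : IsTracialState τ) (h : IsComplProj p q) (hp : τ p ≠ 0)
    (hq : τ q ≠ 0) (hC : ∀ s, C.mulVec (v s) = fun a => (lam s : ℂ) * v s a)
    {E E' : Matrix κ κ A →ₗ[ℂ] Matrix κ κ A}
    (hE : IsCondExp (StarAlgebra.adjoin ℂ {tensor p 1, tensor q 1, tensor 1 C}) E)
    (hE' : IsCondExp (StarAlgebra.adjoin ℂ {tensor p 1, tensor q 1, tensor 1 C}) E')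
    (ht : ∀ X, tensorTrace τ (E X) = tensorTrace τ X)
    (ht' : ∀ X, tensorTrace τ (E' X) = tensorTrace τ X) : E' = E := by
  have hsub : ∀ X Y : Matrix κ κ A, tensorTrace τ (X - Y) = tensorTrace τ X - tensorTrace τ Y := by
    intro X Y
    simp only [tensorTrace, Matrix.sub_apply, map_sub, Finset.sum_sub_distrib, mul_sub]
  ext1 X
  rw [← sub_eq_zero]
  have hZ := sub_mem (hE'.mem X) (hE.mem X)
  set Z := E' X - E X with hZdef
  have hl : ∀ (F : Matrix κ κ A →ₗ[ℂ] Matrix κ κ A),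
      IsCondExp (StarAlgebra.adjoin ℂ {tensor p 1, tensor q 1, tensor 1 C}) F →
      F (star Z * X) = star Z * F X := fun F hF => by
    simpa using hF.bimodule _ (star_mem hZ) 1 (one_mem _) X
  have h0 : tensorTrace τ (star Z * Z) = 0 := by
    conv_lhs => enter [2, 2]; rw [hZdef]
    rw [mul_sub, hsub, ← hl E hE, ← hl E' hE', ht, ht', sub_self]
  rw [tensorTrace_eq v hτ, map_mul, map_star, mul_eq_zero] at h0
  apply EquivLike.injective (inBasis A v)
  rw [map_zero]
  exact eq_zero_of_sum_trace_star_mul_eq_zero hτ h hp hq ((mem_adjoin_tensor_iff v h hC).1 hZ)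
    (h0.resolve_left (by simp))

/-- Entrywise freeness implies freeness over the algebra generated by `⟨p, q⟩` and `C`, provided
that on the two algebras the expectation acts entrywise. -/
theorem freeOver_basisExp {I : Type*} {S : I → Set A} {T : I → Set (Matrix κ κ A)}
    (h : IsComplProj p q) (hp : τ p ≠ 0) (hq : τ q ≠ 0)
    (hfree : FreeOver (StarAlgebra.adjoin ℂ {p, q}) (cornerExp τ p q) S)
    (B : StarSubalgebra ℂ (Matrix κ κ A))
    (hmem : ∀ i, ∀ X ∈ StarAlgebra.adjoin ℂ (T i ∪ (B : Set (Matrix κ κ A))), ∀ s t,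
      inBasis A v X s t ∈ StarAlgebra.adjoin ℂ (S i ∪ (StarAlgebra.adjoin ℂ {p, q} : Set A)))
    (hmap : ∀ i, ∀ X ∈ StarAlgebra.adjoin ℂ (T i ∪ (B : Set (Matrix κ κ A))),
      diagAvg lam (cornerExp τ p q) (inBasis A v X) = (inBasis A v X).map (cornerExp τ p q)) :
    FreeOver B (basisExp v lam (cornerExp τ p q)) T := by
  intro l hne hc hl
  set E := basisExp v lam (cornerExp τ p q)
  have key := hfree.map_list_prod_apply (l.map fun z => (z.1, inBasis A v (z.2 - E z.2)))
    (by simpa using hne) (by simpa [Function.comp_def] using hc) (by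
      rw [List.forall_mem_map]
      intro z hz s t
      dsimp only
      -- The expectation being entrywise here, the entries of the centred matrix are `a - ψ a`, and
      -- `ψ` kills these because it fixes `⟨p, q⟩`.
      rw [map_sub, inBasis_basisExp, hmap z.1 z.2 (hl z hz), Matrix.sub_apply, Matrix.map_apply]
      refine ⟨sub_mem (hmem _ _ (hl z hz) s t) (StarAlgebra.subset_adjoin _ _
        (Or.inr (cornerExp_mem h _))), ?_⟩
      rw [map_sub, cornerExp_of_mem h hp hq (cornerExp_mem h _), sub_self])
  apply EquivLike.injective (inBasis A v)
  rw [inBasis_basisExp, map_list_prod, map_zero, List.map_map]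
  rw [List.map_map] at key
  rw [diagAvg_apply, Matrix.diagonal_eq_zero]
  funext s
  exact (congrArg _ (Finset.sum_eq_zero fun t _ => key t t)).trans (smul_zero _)

end ChangeOfBasis

end

/-! ### Matrix units, the elements `w_s` and the matrix `f f^*`. -/

section

variable {A : Type*} [Ring A] [StarRing A] [Algebra ℂ A] [StarModule ℂ A]

variable {m n : ℕ} {e : Fin m ⊕ Fin n → Fin m ⊕ Fin n → A}

namespace IsMatrixUnits

theorem isComplProj (he : IsMatrixUnits e) : IsComplProj (projM e) (projN e) where
  idem := by simp [projM, Finset.sum_mul_sum, he.mul]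
  star_eq := by simp [projM, he.star]
  add_eq := by rw [← he.sum_diag, Fintype.sum_sum_type, projM, projN]

theorem trace_diag {τ : A →ₗ[ℂ] ℂ} (he : IsMatrixUnits e) (hτ : IsTracialState τ)
    (i j : Fin m ⊕ Fin n) : τ (e i i) = τ (e j j) := by
  have := hτ.trace (e i j) (e j i)
  rwa [he.mul, he.mul, if_pos rfl, if_pos rfl] at this

/-- All diagonal units have the same trace, and these traces sum to 1. -/
theorem trace_diag_ne_zero {τ : A →ₗ[ℂ] ℂ} (he : IsMatrixUnits e) (hτ : IsTracialState τ)
    (i : Fin m ⊕ Fin n) : τ (e i i) ≠ 0 := by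
  intro h0
  have := hτ.map_one
  rw [← he.sum_diag, map_sum, Finset.sum_eq_zero fun j _ => (he.trace_diag hτ j i).trans h0] at this
  exact zero_ne_one this

theorem trace_projM_ne_zero {τ : A →ₗ[ℂ] ℂ} (he : IsMatrixUnits e) (hτ : IsTracialState τ)
    [NeZero m] : τ (projM e) ≠ 0 := by
  rw [projM, map_sum, Finset.sum_congr rfl fun i _ => he.trace_diag hτ (.inl i) (.inl 0)]
  simpa using ⟨NeZero.ne m, he.trace_diag_ne_zero hτ _⟩

theorem trace_projN_ne_zero {τ : A →ₗ[ℂ] ℂ} (he : IsMatrixUnits e) (hτ : IsTracialState τ)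
    [NeZero n] : τ (projN e) ≠ 0 := by
  rw [projN, map_sum, Finset.sum_congr rfl fun i _ => he.trace_diag hτ (.inr i) (.inr 0)]
  simpa using ⟨NeZero.ne n, he.trace_diag_ne_zero hτ _⟩

theorem w_mul_projM (he : IsMatrixUnits e) (v : TensorBasis m n) (s : Fin (m * n)) :
    w e v s * projM e = w e v s := by
  simp only [w, projM, Finset.sum_mul, Finset.mul_sum, smul_mul_assoc, he.mul, Sum.inl.injEq,
    smul_ite, smul_zero]
  rw [Finset.sum_comm]
  simp

end IsMatrixUnits

theorem w_mem {S : StarSubalgebra ℂ A} (hS : ∀ i j, e i j ∈ S) (v : TensorBasis m n)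
    (s : Fin (m * n)) : w e v s ∈ S :=
  sum_mem fun _ _ => sum_mem fun _ _ => SMulMemClass.smul_mem _ (hS _ _)

variable {v : TensorBasis m n} {lam : Fin (m * n) → ℝ}

/-- The column `f` is the basis matrix times the column `g` of the `w_s^*`, cut off at eigenvalue 0,
so the change of basis turns `f f^*` into `g g^*`. -/
theorem inBasis_f_mul_conjTranspose :
    inBasis A v (f e v lam * (f e v lam).conjTranspose) = Matrix.of fun s t =>
      star (w e v s) * (if lam s = 0 ∨ lam t = 0 then 0 else 1) * w e v t := by
  let g : Matrix (Fin (m * n)) Unit A :=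
    Matrix.of fun s _ => if lam s = 0 then 0 else star (w e v s)
  have hf : f e v lam = basisMatrix A v * g := by
    ext a
    simp [f, g, basisMatrix, Matrix.mul_apply, Finset.sum_filter, ← Algebra.smul_def, ite_not]
  have hg : inBasis A v (f e v lam * (f e v lam).conjTranspose) = g * g.conjTranspose := by
    rw [hf, Matrix.conjTranspose_mul, ← Matrix.mul_assoc, Matrix.mul_assoc (basisMatrix A v)]
    exact (inBasis A v).apply_symm_apply _
  rw [hg]
  ext s t
  by_cases hs : lam s = 0 <;> by_cases ht : lam t = 0 <;>
    simp [g, Matrix.mul_apply, hs, ht]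

theorem inBasis_mem_diagSubalgebra (he : IsMatrixUnits e)
    {C : Matrix (Fin n × Fin m) (Fin n × Fin m) ℂ}
    (hv : ∀ s, C.mulVec (v s) = fun a => (lam s : ℂ) * v s a) (x : A)
    {X : Matrix (Fin n × Fin m) (Fin n × Fin m) A}
    (hX : X ∈ StarAlgebra.adjoin ℂ ({tensor x C} ∪ (algB e C : Set (Matrix _ _ A)))) :
    inBasis A v X ∈ diagSubalgebra lam (StarAlgebra.adjoin ℂ
      ({x} ∪ (StarAlgebra.adjoin ℂ {projM e, projN e} : Set A))) := by
  suffices StarAlgebra.adjoin ℂ ({tensor x C} ∪ (algB e C : Set (Matrix _ _ A))) ≤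
      (diagSubalgebra lam (StarAlgebra.adjoin ℂ
        ({x} ∪ (StarAlgebra.adjoin ℂ {projM e, projN e} : Set A)))).comap
        (inBasis A v : Matrix (Fin n × Fin m) (Fin n × Fin m) A →⋆ₐ[ℂ] Matrix _ _ A) from this hX
  refine StarAlgebra.adjoin_le ?_
  rintro _ (rfl | hb)
  · exact ⟨fun ρ => (ρ : ℂ) • x, fun ρ => SMulMemClass.smul_mem _
      (StarAlgebra.subset_adjoin _ _ (by simp)), inBasis_tensor v hv x⟩
  · exact diagSubalgebra_mono lam
      (fun a ha => StarAlgebra.subset_adjoin ℂ _ (Or.inr ha))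
      ((mem_adjoin_tensor_iff v he.isComplProj hv).1 hb)

theorem inBasis_mem_sandwichSubalgebra (he : IsMatrixUnits e)
    {C : Matrix (Fin n × Fin m) (Fin n × Fin m) ℂ}
    (hv : ∀ s, C.mulVec (v s) = fun a => (lam s : ℂ) * v s a)
    {X : Matrix (Fin n × Fin m) (Fin n × Fin m) A}
    (hX : X ∈ StarAlgebra.adjoin ℂ
      ({f e v lam * (f e v lam).conjTranspose} ∪ (algB e C : Set (Matrix _ _ A)))) :
    inBasis A v X ∈ sandwichSubalgebra he.isComplProj lam (he.w_mul_projM v) := by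
  suffices StarAlgebra.adjoin ℂ
      ({f e v lam * (f e v lam).conjTranspose} ∪ (algB e C : Set (Matrix _ _ A))) ≤
      (sandwichSubalgebra he.isComplProj lam (he.w_mul_projM v)).comap
        (inBasis A v : Matrix (Fin n × Fin m) (Fin n × Fin m) A →⋆ₐ[ℂ] Matrix _ _ A) from this hX
  refine StarAlgebra.adjoin_le ?_
  rintro _ (rfl | hb)
  -- The kernel for `f f^*` is the indicator of both eigenvalues being nonzero, with no diagonal
  -- part.
  · refine ⟨0, 0, fun ρ σ => if ρ = 0 ∨ σ = 0 then 0 else 1, fun ρ σ => ?_, by simp, by simp, ?_⟩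
    · dsimp only
      split_ifs
      exacts [zero_mem _, one_mem _]
    · refine (inBasis_f_mul_conjTranspose (e := e) (v := v) (lam := lam)).trans ?_
      simp
  · obtain ⟨d, hd, hX⟩ := (mem_adjoin_tensor_iff v he.isComplProj hv).1 hb
    choose α β hαβ using fun ρ => he.isComplProj.mem_adjoin_iff.1 (hd ρ)
    refine ⟨α, β, fun _ _ => 0, fun _ _ => zero_mem _, fun _ => rfl, fun _ => rfl, ?_⟩
    simp only [← hαβ, mul_zero, zero_mul]
    exact hX.trans (add_zero _).symm

theorem apply_mem_of_mem_sandwichSubalgebra (he : IsMatrixUnits e)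
    {Y : Matrix (Fin (m * n)) (Fin (m * n)) A}
    (hY : Y ∈ sandwichSubalgebra he.isComplProj lam (he.w_mul_projM v))
    {S : StarSubalgebra ℂ A} (hS : ∀ i j, e i j ∈ S) (s t : Fin (m * n)) : Y s t ∈ S := by
  obtain ⟨α, β, h, hh, -, -, rfl⟩ := hY
  have hle : levelAlg lam (w e v) ≤ S := by
    refine StarAlgebra.adjoin_le ?_
    rintro _ ⟨ρ, -, rfl⟩
    exact sum_mem fun s _ => mul_mem (w_mem hS v s) (star_mem (w_mem hS v s))
  rw [Matrix.add_apply, Matrix.of_apply, Matrix.diagonal_apply]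
  refine add_mem ?_ (mul_mem (mul_mem (star_mem (w_mem hS v s)) (hle (hh _ _))) (w_mem hS v t))
  split_ifs
  · exact add_mem (SMulMemClass.smul_mem _ (sum_mem fun _ _ => hS _ _))
      (SMulMemClass.smul_mem _ (sum_mem fun _ _ => hS _ _))
  · exact zero_mem _

theorem freeOver_tensor_f {τ : A →ₗ[ℂ] ℂ} (hτ : IsTracialState τ) (he : IsMatrixUnits e)
    [NeZero m] [NeZero n] {x : A}
    (hfree : FreeOver (StarAlgebra.adjoin ℂ {projM e, projN e})
      (cornerExp τ (projM e) (projN e)) ![{x}, Set.range (Function.uncurry e)])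
    {C : Matrix (Fin n × Fin m) (Fin n × Fin m) ℂ}
    (hv : ∀ s, C.mulVec (v s) = fun a => (lam s : ℂ) * v s a)
    (hC : TraciallyWellBehaved τ e v lam) :
    FreeOver (algB e C) (basisExp v lam (cornerExp τ (projM e) (projN e)))
      ![{tensor x C}, {f e v lam * (f e v lam).conjTranspose}] := by
  refine freeOver_basisExp he.isComplProj (he.trace_projM_ne_zero hτ) (he.trace_projN_ne_zero hτ)
    hfree _ (Fin.forall_fin_two.2 ⟨fun X hX s t => ?_, fun X hX s t => ?_⟩)
    (Fin.forall_fin_two.2 ⟨fun X hX => ?_, fun X hX => ?_⟩)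
  · obtain ⟨d, hd, hdX⟩ := inBasis_mem_diagSubalgebra he hv x hX
    rw [hdX, Matrix.diagonal_apply]
    split_ifs
    exacts [hd _, zero_mem _]
  · exact apply_mem_of_mem_sandwichSubalgebra he (inBasis_mem_sandwichSubalgebra he hv hX)
      (fun i j => StarAlgebra.subset_adjoin _ _ (Or.inl ⟨(i, j), rfl⟩)) s t
  · exact diagAvg_of_mem_diagSubalgebra _ (inBasis_mem_diagSubalgebra he hv x hX)
  · exact diagAvg_of_mem_sandwichSubalgebra hτ he.isComplProj (he.w_mul_projM v)
      -- The second equality contains the first, on taking `j₁' = j₁`.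
      (fun L hL j₁ j₁' j₂ h0 h1 => (hC L hL j₁ j₁' j₂ h0 h1).2)
      (inBasis_mem_sandwichSubalgebra he hv hX)

end

end BlockModified

end

theorem mainTheorem2 {m n : ℕ}
    {A : Type*} [Ring A] [StarRing A] [Algebra ℂ A] [StarModule ℂ A]
    (τ : A →ₗ[ℂ] ℂ) (hτ : BlockModified.IsTracialState τ)
    (e : Fin m ⊕ Fin n → Fin m ⊕ Fin n → A) (he : BlockModified.IsMatrixUnits e)
    (x : A) (hx : IsSelfAdjoint x)
    (hxm : x = BlockModified.projM e * x * BlockModified.projM e)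
    (hfree : BlockModified.FreeOver
      (StarAlgebra.adjoin ℂ {BlockModified.projM e, BlockModified.projN e})
      (BlockModified.cornerExp τ (BlockModified.projM e) (BlockModified.projN e))
      ![{x}, Set.range (Function.uncurry e)])
    (φ : Matrix (Fin m) (Fin m) ℂ →ₗ[ℂ] Matrix (Fin n) (Fin n) ℂ)
    (v : BlockModified.TensorBasis m n) (lam : Fin (m * n) → ℝ)
    (hv : ∀ s, (BlockModified.choi φ).mulVec (v s) = fun a => (lam s : ℂ) * v s a)
    (hC : BlockModified.TraciallyWellBehaved τ e v lam) :
    (∀ a ∈ BlockModified.algB e (BlockModified.choi φ),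
      ∀ b ∈ BlockModified.algB e (BlockModified.choi φ), a * b = b * a) ∧
    ∃ E : Matrix (Fin n × Fin m) (Fin n × Fin m) A →ₗ[ℂ]
        Matrix (Fin n × Fin m) (Fin n × Fin m) A,
      BlockModified.IsCondExp (BlockModified.algB e (BlockModified.choi φ)) E ∧
      (∀ X, BlockModified.tensorTrace τ (E X) = BlockModified.tensorTrace τ X) ∧
      (∀ E' : Matrix (Fin n × Fin m) (Fin n × Fin m) A →ₗ[ℂ]
          Matrix (Fin n × Fin m) (Fin n × Fin m) A,
        BlockModified.IsCondExp (BlockModified.algB e (BlockModified.choi φ)) E' →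
        (∀ X, BlockModified.tensorTrace τ (E' X) = BlockModified.tensorTrace τ X) → E' = E) ∧
      BlockModified.FreeOver (BlockModified.algB e (BlockModified.choi φ)) E
        ![{BlockModified.tensor x (BlockModified.choi φ)},
          {BlockModified.f e v lam * (BlockModified.f e v lam).conjTranspose}] := by
  -- If `m` or `n` is 0, the matrix algebra is trivial and every claim is an identity between equal
  -- elements.
  rcases isEmpty_or_nonempty (Fin n × Fin m) with hemp | hne
  · exact ⟨fun _ _ _ _ => Subsingleton.elim _ _, 0,
      ⟨fun _ => zero_mem _, fun _ _ _ _ _ => Subsingleton.elim _ _, Subsingleton.elim _ _⟩,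
      fun X => congrArg _ (Subsingleton.elim _ _),
      fun _ _ _ => LinearMap.ext fun _ => Subsingleton.elim _ _,
      fun _ _ _ _ => Subsingleton.elim _ _⟩
  · have : NeZero m := ⟨by rintro rfl; exact hne.elim fun z => z.2.elim0⟩
    have : NeZero n := ⟨by rintro rfl; exact hne.elim fun z => z.1.elim0⟩
    have hpq := he.isComplProj
    have hp := he.trace_projM_ne_zero hτ
    have hq := he.trace_projN_ne_zero hτ
    have hE := BlockModified.isCondExp_basisExp hpq hp hq hv
    have ht := BlockModified.tensorTrace_basisExp (v := v) (lam := lam) hτ hpq hp hq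
    refine ⟨fun a ha b hb => ?_,
      BlockModified.basisExp v lam
        (BlockModified.cornerExp τ (BlockModified.projM e) (BlockModified.projN e)),
      hE, ht, fun E' hE' ht' => BlockModified.condExp_unique hτ hpq hp hq hv hE hE' ht ht',
      BlockModified.freeOver_tensor_f hτ he hfree hv hC⟩
    obtain ⟨d, hd, hda⟩ := (BlockModified.mem_adjoin_tensor_iff v hpq hv).1 ha
    obtain ⟨d', hd', hdb⟩ := (BlockModified.mem_adjoin_tensor_iff v hpq hv).1 hb
    apply EquivLike.injective (BlockModified.inBasis A v)
    simp only [map_mul, hda, hdb, Matrix.diagonal_mul_diagonal, hpq.commute_of_mem (hd _) (hd' _)]
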